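/- For positive integers $k\ge 2$, $l\ge 1$ and $a,b\in\mathbb{Z}/2\mathbb{Z}$ let $$\zeta_2(k,l;a,b)=\sum_{\substack{m>n>0\\ m\equiv a,\ n\equiv b\ (\mathrm{mod}\ 2)}}\frac{4}{m^k n^l}$$ be the double zeta value of level $2$. An argument is written with a bar if its residue is $1$ and without a bar if its residue is $0$; thus $\zeta_2(k,l)=\zeta_2(k,l;0,0)$, $\zeta_2(\overline{k},l)=\zeta_2(k,l;1,0)$, $\zeta_2(k,\overline{l})=\zeta_2(k,l;0,1)$ and $\zeta_2(\overline{k},\overline{l})=\zeta_2(k,l;1,1)$. For positive integers $k,l$ let $$\zeta^{(2)}(\overline{k},l)=\sum_{m>n>0}\frac{(-1)^{m}}{m^k n^l},\qquad \zeta^{(2)}(\overline{k},\overline{l})=\sum_{m>n>0}\frac{(-1)^{m+n}}{m^k n^l}$$ be the alternating double zeta values, where the sums are understood as the limits as $M\to\infty$ of the sums over $M\ge m>n>0$. Then for every integer $k\ge 3$ all the series occurring below converge (those defining the values $\zeta_2$ absolutely), and $$\sum_{j=2}^{k-1}\zeta_2(j,k-j)=\frac{1}{2^{k-2}}\zeta(k),$$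 $$\sum_{j=2}^{k-1}\zeta_2(\overline{j},k-j)=2\left(\zeta^{(2)}(\overline{k-1},1)-\zeta^{(2)}(\overline{k-1},\overline{1})\right),$$ $$\sum_{j=2}^{k-1}\zeta_2(j,\overline{k-j})=2\left(\zeta^{(2)}(\overline{k-1},\overline{1})+\zeta^{(2)}(\overline{1},\overline{k-1})-\zeta^{(2)}(\overline{k-1},1)-\zeta^{(2)}(\overline{1},k-1)\right)+4\left(1-\frac{1}{2^k}\right)\zeta(k),$$ $$\sum_{j=2}^{k-1}\zeta_2(\overline{j},\overline{k-j})=2\left(\zeta^{(2)}(\overline{1},k-1)-\zeta^{(2)}(\overline{1},\overline{k-1})\right).$$ -/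

import Mathlib

open Filter Topology

namespace DoubleZeta

/-- The index set of a double zeta value of level `N`: pairs `m > n > 0` of integers with
`m ≡ a` and `n ≡ b` modulo `N`. -/
def levelIndex (N : ℕ) (a b : ZMod N) : Set (ℕ × ℕ) :=
  {p | 0 < p.2 ∧ p.2 < p.1 ∧ (p.1 : ZMod N) = a ∧ (p.2 : ZMod N) = b}

/-- The term `N ^ 2 / (m ^ k * n ^ l)` of a double zeta value of level `N`, for `p = (m, n)`. -/
noncomputable def levelTerm (N k l : ℕ) (p : ℕ × ℕ) : ℝ :=
  (N : ℝ) ^ 2 / ((p.1 : ℝ) ^ k * (p.2 : ℝ) ^ l)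

/-- The double zeta value of level `N`, written `ζ_N(k, l; a, b)`: the sum of
`N ^ 2 / (m ^ k * n ^ l)` over all `m > n > 0` with `m ≡ a`, `n ≡ b` modulo `N`.
For `N = 2` an argument is written with a bar when its residue is `1`, without when it is `0`. -/
noncomputable def levelZeta (N k l : ℕ) (a b : ZMod N) : ℝ :=
  ∑' p : levelIndex N a b, levelTerm N k l p

/-- The partial sum over `M ≥ m > n > 0` of the alternating double series
`(-1) ^ (a * m + b * n) / (m ^ k * n ^ l)`. -/
noncomputable def altPartialSum (k l : ℕ) (a b : ZMod 2) (M : ℕ) : ℝ :=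
  ∑ m ∈ Finset.Icc 1 M, ∑ n ∈ Finset.Ico 1 m,
    (-1 : ℝ) ^ (a.val * m + b.val * n) / ((m : ℝ) ^ k * (n : ℝ) ^ l)

/-- The alternating double zeta value: the limit of the partial sums. The series is only
conditionally convergent for `k = 1`, `a = 1`. An argument is written with a bar when its sign
index is `1`, without when it is `0`. -/
noncomputable def altZeta (k l : ℕ) (a b : ZMod 2) : ℝ :=
  limUnder atTop (altPartialSum k l a b)

end DoubleZeta

namespace DoubleZeta

/-! Put w = k - 1. Summing a geometric progression gives ∑_{j=2}^{w} 1/(m^j n^{w+1-j}) = 1/(n^w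
(m-n)) - 1/(m^w (m-n)) - 1/(n^w m) (`sum_one_div_pow_mul_pow`). If m ≡ a and n ≡ b, then m - n ≡ a -
b, so summing over M ≥ m > n turns each piece into a single sum of 1/n^w against harmonic sums H_c
restricted to a residue class c (`sum_triangle_eq`).

The pieces may diverge like log M separately, so everything stays truncated at M. The only awkward
quantity is H_{a-b}(M-n); replacing it by H_{a-b}(M) costs o(1) (`tendsto_error`). The truncated
alternating sums have the same shape, because (-1)^n is the even indicator minus the odd one. Each
formula is then an identity between summands at fixed n and M, checked for n even and n odd; the
ζ(k) terms are the diagonal contributions H_c(n) - H_c(n-1). -/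

/-- The indicator function of the residue class `c` modulo `2`. -/
noncomputable def parityInd (c : ZMod 2) (n : ℕ) : ℝ := if (n : ZMod 2) = c then 1 else 0

/-- The sum of `1 / r` over the positive `r ≤ N` in the residue class `c` modulo `2`. -/
noncomputable def parityHarmonic (c : ZMod 2) (N : ℕ) : ℝ :=
  ∑ r ∈ Finset.Icc 1 N, parityInd c r / r

/-! ### Parity indicators and growth of the restricted harmonic sums -/

lemma parityInd_nonneg (c : ZMod 2) (n : ℕ) : 0 ≤ parityInd c n := by
  unfold parityInd; split_ifs <;> norm_num

lemma parityInd_le_one (c : ZMod 2) (n : ℕ) : parityInd c n ≤ 1 := by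
  unfold parityInd; split_ifs <;> norm_num

lemma parityInd_zero_add_one (n : ℕ) : parityInd 0 n + parityInd 1 n = 1 := by
  unfold parityInd
  generalize (n : ZMod 2) = x
  obtain rfl | rfl : x = 0 ∨ x = 1 := by revert x; decide
  · simp
  · simp

lemma parityInd_zero_sub_one (n : ℕ) : parityInd 0 n - parityInd 1 n = (-1) ^ n := by
  rcases Nat.even_or_odd n with h | h
  · simp [parityInd, h.neg_one_pow, (ZMod.natCast_eq_zero_iff_even).2 h]
  · simp [parityInd, h.neg_one_pow, (ZMod.natCast_eq_one_iff_odd).2 h]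

lemma parityInd_mul_parityInd_sub (a b : ZMod 2) {m n : ℕ} (h : n ≤ m) :
    parityInd a m * parityInd b n = parityInd a m * parityInd (a - b) (m - n) := by
  unfold parityInd
  rw [Nat.cast_sub h]
  by_cases hm : (m : ZMod 2) = a
  · simp [hm, eq_comm]
  · simp [hm]

lemma parityInd_mul_parityInd_sub' (a b : ZMod 2) {m n : ℕ} (h : n ≤ m) :
    parityInd a m * parityInd b n = parityInd b n * parityInd (a - b) (m - n) := by
  unfold parityInd
  rw [Nat.cast_sub h]
  by_cases hn : (n : ZMod 2) = b
  · simp [hn]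
  · simp [hn]

lemma parityHarmonic_succ (c : ZMod 2) (n : ℕ) :
    parityHarmonic c (n + 1) = parityHarmonic c n + parityInd c (n + 1) / ((n + 1 : ℕ) : ℝ) := by
  unfold parityHarmonic
  rw [Finset.sum_Icc_succ_top (by omega)]

lemma parityHarmonic_eq_pred (c : ZMod 2) {n : ℕ} (hn : 1 ≤ n) :
    parityHarmonic c n = parityHarmonic c (n - 1) + parityInd c n / (n : ℝ) := by
  obtain ⟨n, rfl⟩ := Nat.exists_eq_add_of_le' hn
  exact parityHarmonic_succ c n

lemma sum_Ico_eq_parityHarmonic (c : ZMod 2) (m : ℕ) :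
    ∑ r ∈ Finset.Ico 1 m, parityInd c r / r = parityHarmonic c (m - 1) := by
  unfold parityHarmonic
  congr 1

lemma sum_Ioc_eq_parityHarmonic_sub (c : ZMod 2) {n M : ℕ} (h : n ≤ M) :
    ∑ r ∈ Finset.Ioc n M, parityInd c r / r = parityHarmonic c M - parityHarmonic c n := by
  have e (N : ℕ) : Finset.Icc 1 N = Finset.Ioc 0 N := by
    ext r; simp only [Finset.mem_Icc, Finset.mem_Ioc]; omega
  unfold parityHarmonic
  rw [e, e, ← Finset.sum_Ioc_consecutive _ (Nat.zero_le n) h]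
  ring

lemma parityHarmonic_mono (c : ZMod 2) : Monotone (parityHarmonic c) :=
  monotone_nat_of_le_succ fun n => by
    rw [parityHarmonic_succ]
    have := parityInd_nonneg c (n + 1)
    have : 0 ≤ parityInd c (n + 1) / ((n + 1 : ℕ) : ℝ) := by positivity
    linarith

lemma parityHarmonic_add_sub_le (c : ZMod 2) (N n : ℕ) :
    parityHarmonic c (N + n) - parityHarmonic c N ≤ n / (N + 1 : ℝ) := by
  induction n with
  | zero => simp
  | succ n ih =>
    rw [← add_assoc, parityHarmonic_succ]
    have : parityInd c (N + n + 1) / ((N + n + 1 : ℕ) : ℝ) ≤ 1 / (N + 1 : ℝ) := by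
      apply div_le_div₀ zero_le_one (parityInd_le_one _ _) (by positivity)
      push_cast; linarith [(Nat.cast_nonneg n : (0 : ℝ) ≤ n)]
    push_cast at *
    rw [add_div]
    linarith

/-- A bound uniform in `N`, which serves as the dominating function; `parityHarmonic_add_sub_le`
gives the decay for fixed `n`. It telescopes 1/(n+1) ≤ 2(√(n+1) - √n). -/
lemma parityHarmonic_add_sub_le_sqrt (c : ZMod 2) (N n : ℕ) :
    parityHarmonic c (N + n) - parityHarmonic c N ≤ 2 * √n := by
  induction n with
  | zero => simp
  | succ n ih =>
    rw [← add_assoc, parityHarmonic_succ]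
    have h1 : parityInd c (N + n + 1) / ((N + n + 1 : ℕ) : ℝ) ≤ 1 / (n + 1 : ℝ) := by
      apply div_le_div₀ zero_le_one (parityInd_le_one _ _) (by positivity)
      push_cast; linarith [(Nat.cast_nonneg N : (0 : ℝ) ≤ N)]
    have h2 : 1 / (n + 1 : ℝ) ≤ 2 * (√(n + 1) - √n) := by
      have hs := Real.sq_sqrt (by positivity : (0 : ℝ) ≤ n + 1)
      have ht := Real.sq_sqrt (Nat.cast_nonneg n : (0 : ℝ) ≤ n)
      have hs1 : 1 ≤ √(n + 1 : ℝ) := Real.one_le_sqrt.2 (by simp)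
      have hst : √n ≤ √(n + 1 : ℝ) := Real.sqrt_le_sqrt (by simp)
      have ht0 := Real.sqrt_nonneg (n : ℝ)
      generalize √(n + 1 : ℝ) = s at *
      generalize √(n : ℝ) = t at *
      rw [← hs, div_le_iff₀ (by positivity)]
      have h3 : (s - t) * (s + t) = 1 := by nlinarith
      have h4 : (s - t) * (s + t) ≤ (s - t) * (2 * s ^ 2) :=
        mul_le_mul_of_nonneg_left (by nlinarith) (by linarith)
      nlinarith
    push_cast at *
    linarith

lemma parityHarmonic_zero (c : ZMod 2) : parityHarmonic c 0 = 0 := by simp [parityHarmonic]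

lemma parityHarmonic_nonneg (c : ZMod 2) (n : ℕ) : 0 ≤ parityHarmonic c n := by
  rw [← parityHarmonic_zero c]; exact parityHarmonic_mono c (Nat.zero_le n)

lemma parityHarmonic_le_sqrt (c : ZMod 2) (n : ℕ) : parityHarmonic c n ≤ 2 * √n := by
  simpa [parityHarmonic_zero] using parityHarmonic_add_sub_le_sqrt c 0 n

/-! ### Summability and the vanishing error term -/

lemma summable_sqrt_div_sq : Summable fun n : ℕ => √(n : ℝ) / (n : ℝ) ^ 2 := by
  have h : Summable fun n : ℕ => ((n : ℝ) ^ (3 / 2 : ℝ))⁻¹ :=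
    Real.summable_nat_rpow_inv.2 (by norm_num)
  refine h.congr fun n => ?_
  rcases Nat.eq_zero_or_pos n with rfl | hn
  · simp
  · have hn' : (0 : ℝ) < n := by exact_mod_cast hn
    rw [Real.sqrt_eq_rpow, ← Real.rpow_natCast, ← Real.rpow_neg hn'.le, ← Real.rpow_sub hn']
    norm_num

lemma one_div_natCast_pow_le (n : ℕ) {w : ℕ} (hw : 2 ≤ w) :
    1 / (n : ℝ) ^ w ≤ 1 / (n : ℝ) ^ 2 := by
  rcases Nat.eq_zero_or_pos n with rfl | hn
  · simp [show w ≠ 0 by omega]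
  · have hn' : (1 : ℝ) ≤ n := by exact_mod_cast hn
    exact one_div_le_one_div_of_le (by positivity) (pow_le_pow_right₀ hn' hw)

/-- A sequence dominated by `√n` is summable against `1 / n ^ w` for `w ≥ 2`. -/
lemma summable_div_pow_of_abs_le_sqrt {w : ℕ} (hw : 2 ≤ w) {g : ℕ → ℝ} (C : ℝ)
    (hg : ∀ n, |g n| ≤ C * √n) : Summable fun n : ℕ => 1 / (n : ℝ) ^ w * g n := by
  refine Summable.of_norm_bounded (summable_sqrt_div_sq.mul_left C) fun n => ?_
  rw [norm_mul, Real.norm_eq_abs, Real.norm_eq_abs, abs_of_nonneg (by positivity)]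
  calc 1 / (n : ℝ) ^ w * |g n| ≤ 1 / (n : ℝ) ^ 2 * (C * √n) :=
        mul_le_mul (one_div_natCast_pow_le n hw) (hg n) (abs_nonneg _) (by positivity)
    _ = _ := by ring

lemma tendsto_sum_Icc_of_summable {f : ℕ → ℝ} (hf : Summable f) (h0 : f 0 = 0) :
    Tendsto (fun M => ∑ n ∈ Finset.Icc 1 M, f n) atTop (𝓝 (∑' n, f n)) := by
  have := (tendsto_add_atTop_iff_nat 1).2 hf.hasSum.tendsto_sum_nat
  refine this.congr fun M => ?_
  rw [Finset.sum_range_succ', h0, add_zero, Finset.range_eq_Ico,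
    Finset.sum_Ico_add' (fun n => f n) 0 M 1]
  rfl

/-- Dominated convergence over n: for fixed n the difference is at most n/(M-n+1), and for all M the
summand is at most 2√n/n². -/
lemma tendsto_error (b c : ZMod 2) {w : ℕ} (hw : 2 ≤ w) :
    Tendsto (fun M : ℕ => ∑ n ∈ Finset.Icc 1 M,
      1 / (n : ℝ) ^ w * (parityInd b n * (parityHarmonic c M - parityHarmonic c (M - n))))
      atTop (𝓝 0) := by
  have key := tendsto_tsum_of_dominated_convergence (𝓕 := atTop)
    (f := fun (M n : ℕ) => if n ∈ Finset.Icc 1 M then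
      1 / (n : ℝ) ^ w * (parityInd b n * (parityHarmonic c M - parityHarmonic c (M - n))) else 0)
    (g := fun _ : ℕ => (0 : ℝ)) (summable_sqrt_div_sq.mul_left 2) ?_ ?_
  · simp only [tsum_zero] at key
    refine key.congr fun M => ?_
    rw [tsum_eq_sum (s := Finset.Icc 1 M) fun n hn => if_neg hn]
    exact Finset.sum_congr rfl fun n hn => if_pos hn
  · intro n
    have hlim : Tendsto (fun M : ℕ => (n : ℝ) / (((M - n : ℕ) : ℝ) + 1)) atTop (𝓝 0) :=
      (tendsto_const_div_atTop_nhds_zero_nat (n : ℝ)).comp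
        ((tendsto_add_atTop_nat 1).comp (tendsto_sub_atTop_nat n)) |>.congr fun M => by simp
    refine squeeze_zero_norm' ?_ hlim
    filter_upwards [eventually_ge_atTop n] with M hM
    have hb := parityHarmonic_add_sub_le c (M - n) n
    rw [Nat.sub_add_cancel hM] at hb
    have h0 : 0 ≤ parityHarmonic c M - parityHarmonic c (M - n) :=
      sub_nonneg.2 (parityHarmonic_mono c (Nat.sub_le M n))
    split_ifs with hn
    · have h1 : 1 / (n : ℝ) ^ w ≤ 1 := by
        have : (1 : ℝ) ≤ n := by exact_mod_cast (Finset.mem_Icc.1 hn).1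
        exact div_le_one_of_le₀ (one_le_pow₀ this) (by positivity)
      have h2 := parityInd_nonneg b n
      rw [Real.norm_of_nonneg (by positivity)]
      calc _ ≤ 1 * (1 * (parityHarmonic c M - parityHarmonic c (M - n))) :=
            mul_le_mul h1 (mul_le_mul_of_nonneg_right (parityInd_le_one b n) h0)
              (by positivity) zero_le_one
        _ ≤ _ := by simpa using hb
    · simp only [norm_zero]; positivity
  · refine Eventually.of_forall fun M n => ?_
    split_ifs with hn
    · have hb := parityHarmonic_add_sub_le_sqrt c (M - n) n
      rw [Nat.sub_add_cancel (Finset.mem_Icc.1 hn).2] at hb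
      have h0 : 0 ≤ parityHarmonic c M - parityHarmonic c (M - n) :=
        sub_nonneg.2 (parityHarmonic_mono c (Nat.sub_le M n))
      have h2 := parityInd_nonneg b n
      rw [Real.norm_of_nonneg (by positivity)]
      calc _ ≤ 1 / (n : ℝ) ^ 2 * (1 * (2 * √n)) :=
            mul_le_mul (one_div_natCast_pow_le n hw)
              (mul_le_mul (parityInd_le_one b n) hb h0 zero_le_one)
              (by positivity) (by positivity)
        _ = _ := by ring
    · simp only [norm_zero]; positivity

/-! ### Partial fractions and the finite sum formula -/

lemma sum_triangle_comm (f : ℕ → ℕ → ℝ) (M : ℕ) :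
    ∑ m ∈ Finset.Icc 1 M, ∑ n ∈ Finset.Ico 1 m, f m n
      = ∑ n ∈ Finset.Icc 1 M, ∑ m ∈ Finset.Ioc n M, f m n :=
  Finset.sum_comm' fun m n => by
    simp only [Finset.mem_Icc, Finset.mem_Ico, Finset.mem_Ioc]; omega

/-- Partial fractions: the sum of `1 / (m ^ j * n ^ (w + 1 - j))` over `2 ≤ j ≤ w`. -/
lemma sum_one_div_pow_mul_pow {m n : ℕ} (hn : 1 ≤ n) (hnm : n < m) {w : ℕ} (hw : 1 ≤ w) :
    ∑ j ∈ Finset.Icc 2 w, 1 / ((m : ℝ) ^ j * (n : ℝ) ^ (w + 1 - j))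
      = 1 / (n : ℝ) ^ w * (1 / ((m - n : ℕ) : ℝ)) - 1 / (m : ℝ) ^ w * (1 / ((m - n : ℕ) : ℝ))
        - 1 / (n : ℝ) ^ w * (1 / m) := by
  have hn0 : (n : ℝ) ≠ 0 := by positivity
  have hm0 : (m : ℝ) ≠ 0 := by
    have : 0 < m := by omega
    positivity
  have hd : (m : ℝ) - n ≠ 0 := sub_ne_zero.2 (by exact_mod_cast hnm.ne')
  rw [Nat.cast_sub hnm.le]
  induction w, hw using Nat.le_induction with
  | base => simp; field_simp; ring
  | succ w hw ih =>
    rw [Finset.sum_Icc_succ_top (by omega)]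
    have : ∑ j ∈ Finset.Icc 2 w, 1 / ((m : ℝ) ^ j * (n : ℝ) ^ (w + 1 + 1 - j))
        = 1 / n * ∑ j ∈ Finset.Icc 2 w, 1 / ((m : ℝ) ^ j * (n : ℝ) ^ (w + 1 - j)) := by
      rw [Finset.mul_sum]
      refine Finset.sum_congr rfl fun j hj => ?_
      rw [show w + 1 + 1 - j = (w + 1 - j) + 1 by have := (Finset.mem_Icc.1 hj).2; omega, pow_succ]
      field_simp
    rw [this, ih, Nat.add_sub_cancel_left]
    field_simp
    ring

lemma sum_Ico_parityInd_div_sub (a b : ZMod 2) (m : ℕ) :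
    ∑ n ∈ Finset.Ico 1 m, parityInd a m * parityInd b n * (1 / ((m - n : ℕ) : ℝ))
      = parityInd a m * parityHarmonic (a - b) (m - 1) := by
  rw [← sum_Ico_eq_parityHarmonic, Finset.mul_sum]
  refine Finset.sum_nbij' (fun n => m - n) (fun n => m - n) ?_ ?_ ?_ ?_ ?_
  · intro n; simp only [Finset.mem_Ico]; omega
  · intro n; simp only [Finset.mem_Ico]; omega
  · intro n; simp only [Finset.mem_Ico]; omega
  · intro n; simp only [Finset.mem_Ico]; omega
  · intro n hn
    rw [parityInd_mul_parityInd_sub a b (Finset.mem_Ico.1 hn).2.le]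
    ring

lemma sum_Ioc_parityInd_div_sub (a b : ZMod 2) {n M : ℕ} (h : n ≤ M) :
    ∑ m ∈ Finset.Ioc n M, parityInd a m * parityInd b n * (1 / ((m - n : ℕ) : ℝ))
      = parityInd b n * parityHarmonic (a - b) (M - n) := by
  rw [parityHarmonic, Finset.mul_sum]
  refine Finset.sum_nbij' (fun m => m - n) (fun r => r + n) ?_ ?_ ?_ ?_ ?_
  · intro m; simp only [Finset.mem_Ioc, Finset.mem_Icc]; omega
  · intro m; simp only [Finset.mem_Ioc, Finset.mem_Icc]; omega
  · intro m; simp only [Finset.mem_Ioc]; omega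
  · intro m; simp only [Finset.mem_Icc]; omega
  · intro m hm
    rw [parityInd_mul_parityInd_sub' a b (Finset.mem_Ioc.1 hm).1.le]
    ring

/-- The finite form of the sum formula. -/
lemma sum_triangle_eq (a b : ZMod 2) {w : ℕ} (hw : 1 ≤ w) (M : ℕ) :
    ∑ m ∈ Finset.Icc 1 M, ∑ n ∈ Finset.Ico 1 m, parityInd a m * parityInd b n *
        ∑ j ∈ Finset.Icc 2 w, 1 / ((m : ℝ) ^ j * (n : ℝ) ^ (w + 1 - j))
      = ∑ n ∈ Finset.Icc 1 M, 1 / (n : ℝ) ^ w *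
          (parityInd b n * (parityHarmonic (a - b) (M - n) - (parityHarmonic a M
            - parityHarmonic a n)) - parityInd a n * parityHarmonic (a - b) (n - 1)) := by
  have e1 : ∑ m ∈ Finset.Icc 1 M, ∑ n ∈ Finset.Ico 1 m,
      parityInd a m * parityInd b n * (1 / (n : ℝ) ^ w * (1 / ((m - n : ℕ) : ℝ)))
      = ∑ n ∈ Finset.Icc 1 M, 1 / (n : ℝ) ^ w *
          (parityInd b n * parityHarmonic (a - b) (M - n)) := by
    rw [sum_triangle_comm]
    refine Finset.sum_congr rfl fun n hn => ?_
    rw [← sum_Ioc_parityInd_div_sub a b (Finset.mem_Icc.1 hn).2, Finset.mul_sum]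
    exact Finset.sum_congr rfl fun m _ => by ring
  have e2 : ∑ m ∈ Finset.Icc 1 M, ∑ n ∈ Finset.Ico 1 m,
      parityInd a m * parityInd b n * (1 / (m : ℝ) ^ w * (1 / ((m - n : ℕ) : ℝ)))
      = ∑ m ∈ Finset.Icc 1 M, 1 / (m : ℝ) ^ w *
          (parityInd a m * parityHarmonic (a - b) (m - 1)) := by
    refine Finset.sum_congr rfl fun m _ => ?_
    rw [← sum_Ico_parityInd_div_sub a b m, Finset.mul_sum]
    exact Finset.sum_congr rfl fun n _ => by ring
  have e3 : ∑ m ∈ Finset.Icc 1 M, ∑ n ∈ Finset.Ico 1 m,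
      parityInd a m * parityInd b n * (1 / (n : ℝ) ^ w * (1 / m))
      = ∑ n ∈ Finset.Icc 1 M, 1 / (n : ℝ) ^ w *
          (parityInd b n * (parityHarmonic a M - parityHarmonic a n)) := by
    rw [sum_triangle_comm]
    refine Finset.sum_congr rfl fun n hn => ?_
    rw [← sum_Ioc_eq_parityHarmonic_sub a (Finset.mem_Icc.1 hn).2, Finset.mul_sum, Finset.mul_sum]
    exact Finset.sum_congr rfl fun m _ => by ring
  calc _ = ∑ m ∈ Finset.Icc 1 M, ∑ n ∈ Finset.Ico 1 m,
      (parityInd a m * parityInd b n * (1 / (n : ℝ) ^ w * (1 / ((m - n : ℕ) : ℝ)))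
        - parityInd a m * parityInd b n * (1 / (m : ℝ) ^ w * (1 / ((m - n : ℕ) : ℝ)))
        - parityInd a m * parityInd b n * (1 / (n : ℝ) ^ w * (1 / m))) := by
        refine Finset.sum_congr rfl fun m _ => Finset.sum_congr rfl fun n hn => ?_
        rw [sum_one_div_pow_mul_pow (Finset.mem_Ico.1 hn).1 (Finset.mem_Ico.1 hn).2 hw]
        ring
    _ = _ := by
        simp only [Finset.sum_sub_distrib]
        rw [e1, e2, e3, ← Finset.sum_sub_distrib, ← Finset.sum_sub_distrib]
        exact Finset.sum_congr rfl fun n _ => by ring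

/-! ### Alternating sums as single sums -/

lemma parityInd_cases (n : ℕ) :
    (parityInd 0 n = 1 ∧ parityInd 1 n = 0) ∨ (parityInd 0 n = 0 ∧ parityInd 1 n = 1) := by
  unfold parityInd
  generalize (n : ZMod 2) = x
  obtain rfl | rfl : x = 0 ∨ x = 1 := by revert x; decide
  · simp
  · simp

lemma neg_one_pow_mul_eq (b : ZMod 2) (n : ℕ) :
    (-1 : ℝ) ^ (b.val * n) = parityInd 0 n + (-1) ^ b.val * parityInd 1 n := by
  obtain rfl | rfl : b = 0 ∨ b = 1 := by revert b; decide
  · simp [parityInd_zero_add_one]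
  · simp [ZMod.val_one, ← parityInd_zero_sub_one, sub_eq_add_neg]

lemma neg_one_pow_add_mul_eq (b : ZMod 2) (m n : ℕ) :
    (-1 : ℝ) ^ ((1 : ZMod 2).val * m + b.val * n)
      = (parityInd 0 m - parityInd 1 m) * (parityInd 0 n + (-1) ^ b.val * parityInd 1 n) := by
  rw [pow_add, neg_one_pow_mul_eq b n, parityInd_zero_sub_one, ZMod.val_one, one_mul]

lemma altPartialSum_first_bar (w : ℕ) (b : ZMod 2) (M : ℕ) :
    altPartialSum w 1 1 b M = ∑ n ∈ Finset.Icc 1 M, 1 / (n : ℝ) ^ w *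
      ((parityInd 0 n - parityInd 1 n) *
        (parityHarmonic 0 (n - 1) + (-1) ^ b.val * parityHarmonic 1 (n - 1))) := by
  unfold altPartialSum
  refine Finset.sum_congr rfl fun m _ => ?_
  rw [← sum_Ico_eq_parityHarmonic 0 m, ← sum_Ico_eq_parityHarmonic 1 m, Finset.mul_sum,
    ← Finset.sum_add_distrib, Finset.mul_sum, Finset.mul_sum]
  refine Finset.sum_congr rfl fun n _ => ?_
  rw [neg_one_pow_add_mul_eq, div_eq_mul_inv, mul_inv, pow_one]
  ring

/-- Here the exponent 1 sits on the larger variable, so the order of summation is exchanged and the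
inner sum over n < m ≤ M depends on M. -/
lemma altPartialSum_one_bar (w : ℕ) (b : ZMod 2) (M : ℕ) :
    altPartialSum 1 w 1 b M = ∑ n ∈ Finset.Icc 1 M, 1 / (n : ℝ) ^ w *
      ((parityInd 0 n + (-1) ^ b.val * parityInd 1 n) *
        ((parityHarmonic 0 M - parityHarmonic 1 M)
          - (parityHarmonic 0 n - parityHarmonic 1 n))) := by
  unfold altPartialSum
  rw [sum_triangle_comm]
  refine Finset.sum_congr rfl fun n hn => ?_
  have hn := (Finset.mem_Icc.1 hn).2
  have e : (parityHarmonic 0 M - parityHarmonic 1 M) - (parityHarmonic 0 n - parityHarmonic 1 n)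
      = (parityHarmonic 0 M - parityHarmonic 0 n) - (parityHarmonic 1 M - parityHarmonic 1 n) := by
    ring
  rw [e, ← sum_Ioc_eq_parityHarmonic_sub 0 hn, ← sum_Ioc_eq_parityHarmonic_sub 1 hn,
    ← Finset.sum_sub_distrib, Finset.mul_sum, Finset.mul_sum]
  refine Finset.sum_congr rfl fun m _ => ?_
  rw [neg_one_pow_add_mul_eq, div_eq_mul_inv, mul_inv, pow_one]
  ring

lemma abs_neg_one_pow_mul_le (j : ℕ) (x : ℝ) : |(-1) ^ j * x| ≤ |x| := by
  rw [abs_mul, abs_pow, abs_neg, abs_one, one_pow, one_mul]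

lemma abs_parityInd_add_le_one (j n : ℕ) : |parityInd 0 n + (-1) ^ j * parityInd 1 n| ≤ 1 := by
  rcases parityInd_cases n with ⟨h0, h1⟩ | ⟨h0, h1⟩
  · simp [h0, h1]
  · simp [h0, h1]

lemma tendsto_altPartialSum_first_bar {w : ℕ} (hw : 2 ≤ w) (b : ZMod 2) :
    Tendsto (altPartialSum w 1 1 b) atTop (𝓝 (altZeta w 1 1 b)) := by
  refine tendsto_nhds_limUnder ⟨_, (tendsto_sum_Icc_of_summable
    (summable_div_pow_of_abs_le_sqrt hw 4 fun n => ?_) (by simp [show w ≠ 0 by omega])).congr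
      fun M => (altPartialSum_first_bar w b M).symm⟩
  have h1 : |parityInd 0 n - parityInd 1 n| ≤ 1 := by
    simpa [sub_eq_add_neg] using abs_parityInd_add_le_one 1 n
  have hs : √((n - 1 : ℕ) : ℝ) ≤ √n := Real.sqrt_le_sqrt (by exact_mod_cast Nat.sub_le n 1)
  have h2 (c : ZMod 2) : |parityHarmonic c (n - 1)| ≤ 2 * √n := by
    rw [abs_of_nonneg (parityHarmonic_nonneg _ _)]
    linarith [parityHarmonic_le_sqrt c (n - 1)]
  rw [abs_mul]
  calc _ ≤ 1 * (|parityHarmonic 0 (n - 1)| + |(-1) ^ b.val * parityHarmonic 1 (n - 1)|) :=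
        mul_le_mul h1 (abs_add_le _ _) (abs_nonneg _) zero_le_one
    _ ≤ _ := by linarith [h2 0, h2 1, abs_neg_one_pow_mul_le b.val (parityHarmonic 1 (n - 1))]

lemma exists_tendsto_parityHarmonic_sub :
    ∃ l, Tendsto (fun M => parityHarmonic 0 M - parityHarmonic 1 M) atTop (𝓝 l) := by
  have hanti : Antitone fun n : ℕ => 1 / ((n : ℝ) + 1) := fun m n h =>
    one_div_le_one_div_of_le (by positivity) (by simpa using h)
  obtain ⟨l, hl⟩ := hanti.tendsto_alternating_series_of_tendsto_zero
    tendsto_one_div_add_atTop_nhds_zero_nat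
  -- The Leibniz series starts with +1, whereas r = 1 enters here with a minus sign.
  refine ⟨-l, hl.neg.congr fun M => ?_⟩
  induction M with
  | zero => simp [parityHarmonic_zero]
  | succ M ih =>
    rw [Finset.sum_range_succ, parityHarmonic_succ, parityHarmonic_succ, neg_add, ih]
    have h := parityInd_zero_sub_one (M + 1)
    rw [pow_succ] at h
    push_cast
    rw [eq_sub_iff_add_eq.2 (show (-1 : ℝ) ^ M + (parityInd 0 (M + 1) - parityInd 1 (M + 1)) = 0 by
      rw [h]; ring)]
    ring

/-- The M-dependent difference of harmonic sums factors out and converges; it multiplies one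
absolutely convergent series, and another is subtracted. -/
lemma tendsto_altPartialSum_one_bar {w : ℕ} (hw : 2 ≤ w) (b : ZMod 2) :
    Tendsto (altPartialSum 1 w 1 b) atTop (𝓝 (altZeta 1 w 1 b)) := by
  have hw0 : w ≠ 0 := by omega
  refine tendsto_nhds_limUnder ?_
  obtain ⟨l, hl⟩ := exists_tendsto_parityHarmonic_sub
  have hA : Summable fun n : ℕ => 1 / (n : ℝ) ^ w *
      ((parityInd 0 n + (-1) ^ b.val * parityInd 1 n) * (parityHarmonic 0 n - parityHarmonic 1 n)) := by
    refine summable_div_pow_of_abs_le_sqrt hw 4 fun n => ?_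
    rw [abs_mul]
    refine (mul_le_of_le_one_left (abs_nonneg _) (abs_parityInd_add_le_one _ _)).trans ?_
    rw [abs_le]
    constructor <;> linarith [parityHarmonic_nonneg 0 n, parityHarmonic_nonneg 1 n,
      parityHarmonic_le_sqrt 0 n, parityHarmonic_le_sqrt 1 n, Real.sqrt_nonneg (n : ℝ)]
  have hB : Summable fun n : ℕ => 1 / (n : ℝ) ^ w *
      (parityInd 0 n + (-1) ^ b.val * parityInd 1 n) := by
    refine Summable.of_norm_bounded (Real.summable_one_div_nat_pow.2 (by omega : 1 < w)) fun n => ?_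
    rw [norm_mul, Real.norm_of_nonneg (by positivity)]
    exact mul_le_of_le_one_right (by positivity) (abs_parityInd_add_le_one _ _)
  refine ⟨_, (((tendsto_sum_Icc_of_summable hB (by simp [hw0])).mul hl).sub
    (tendsto_sum_Icc_of_summable hA (by simp [hw0]))).congr fun M => ?_⟩
  rw [altPartialSum_one_bar, Finset.sum_mul, ← Finset.sum_sub_distrib]
  exact Finset.sum_congr rfl fun n _ => by ring

/-! ### Level 2 values as limits of truncated sums -/

lemma summable_levelTerm (a b : ZMod 2) {j l : ℕ} (hj : 2 ≤ j) (hl : 1 ≤ l) :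
    Summable fun p : levelIndex 2 a b => levelTerm 2 j l p := by
  have h := ((summable_sqrt_div_sq.mul_of_nonneg summable_sqrt_div_sq
    (fun n => by positivity) (fun n => by positivity)).mul_left 4).comp_injective
      (Subtype.val_injective (p := (· ∈ levelIndex 2 a b)))
  refine Summable.of_nonneg_of_le (fun p => by unfold levelTerm; positivity) ?_ h
  rintro ⟨⟨m, n⟩, hn, hnm, -, -⟩
  simp only [Function.comp_apply, levelTerm] at hn hnm ⊢
  have hn1 : (1 : ℝ) ≤ n := by exact_mod_cast hn
  have hm1 : (n : ℝ) ≤ m := by exact_mod_cast hnm.le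
  have hm0 : (1 : ℝ) ≤ m := hn1.trans hm1
  have h1 : (m : ℝ) ^ 2 * n ≤ (m : ℝ) ^ j * (n : ℝ) ^ l :=
    mul_le_mul (pow_le_pow_right₀ hm0 hj) (by simpa using pow_le_pow_right₀ hn1 hl)
      (by positivity) (by positivity)
  -- Since n < m, half a power can be moved from n to m, so 1/(m² n) is dominated by the product
  -- m^(-3/2) n^(-3/2).
  have h2 : (n : ℝ) ≤ √m * √n := by
    calc (n : ℝ) = √n * √n := (Real.mul_self_sqrt (by positivity)).symm
      _ ≤ _ := mul_le_mul_of_nonneg_right (Real.sqrt_le_sqrt hm1) (Real.sqrt_nonneg _)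
  calc ((2 : ℕ) : ℝ) ^ 2 / ((m : ℝ) ^ j * (n : ℝ) ^ l) ≤ 4 / ((m : ℝ) ^ 2 * n) := by
        norm_num only
        exact div_le_div_of_nonneg_left (by norm_num) (by positivity) h1
    _ = 4 * (n / ((m : ℝ) ^ 2 * (n : ℝ) ^ 2)) := by field_simp
    _ ≤ 4 * ((√m * √n) / ((m : ℝ) ^ 2 * (n : ℝ) ^ 2)) := by gcongr
    _ = _ := by field_simp

/-- Absolute convergence allows summation along growing squares, where only the triangle m > n > 0
contributes. -/
lemma tendsto_levelZeta (a b : ZMod 2) {j l : ℕ} (hj : 2 ≤ j) (hl : 1 ≤ l) :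
    Tendsto (fun M => ∑ m ∈ Finset.Icc 1 M, ∑ n ∈ Finset.Ico 1 m,
      parityInd a m * parityInd b n * (4 * (1 / ((m : ℝ) ^ j * (n : ℝ) ^ l))))
      atTop (𝓝 (levelZeta 2 j l a b)) := by
  have hs := (summable_subtype_iff_indicator (f := levelTerm 2 j l)).1 (summable_levelTerm a b hj hl)
  have ht : levelZeta 2 j l a b = ∑' p, (levelIndex 2 a b).indicator (levelTerm 2 j l) p :=
    tsum_subtype _ _
  have hlim : Tendsto (fun M => Finset.range (M + 1) ×ˢ Finset.range (M + 1))
      atTop (atTop : Filter (Finset (ℕ × ℕ))) := by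
    refine tendsto_atTop_finset_of_monotone (fun M N h => ?_) fun p => ⟨p.1 + p.2, ?_⟩
    · have : Finset.range (M + 1) ⊆ Finset.range (N + 1) :=
        Finset.range_subset_range.2 (by omega)
      exact Finset.product_subset_product this this
    · simp only [Finset.mem_product, Finset.mem_range]; omega
  rw [ht]
  refine (hs.hasSum.comp hlim).congr fun M => ?_
  simp only [Function.comp_apply]
  rw [Finset.sum_product]
  symm
  refine Finset.sum_subset_zero_on_sdiff (fun m => ?_) (fun m hm => ?_) fun m hm => ?_
  · simp only [Finset.mem_Icc, Finset.mem_range]; omega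
  · refine Finset.sum_eq_zero fun n _ => Set.indicator_of_notMem (fun hp => ?_) _
    obtain ⟨h1, h2, -⟩ := hp
    simp only [Finset.mem_sdiff, Finset.mem_Icc, Finset.mem_range] at hm h1 h2
    omega
  · refine Finset.sum_subset_zero_on_sdiff (fun n => ?_) (fun n hn => ?_) fun n hn => ?_
    · simp only [Finset.mem_Icc, Finset.mem_Ico, Finset.mem_range] at hm ⊢; omega
    · refine Set.indicator_of_notMem (fun hp => ?_) _
      obtain ⟨h1, h2, -⟩ := hp
      simp only [Finset.mem_sdiff, Finset.mem_Ico, Finset.mem_range] at hn h1 h2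
      omega
    · have hn := Finset.mem_Ico.1 hn
      by_cases hp : (m, n) ∈ levelIndex 2 a b
      · rw [Set.indicator_of_mem hp]
        simp only [parityInd, if_pos hp.2.2.1, if_pos hp.2.2.2, levelTerm]
        norm_num [div_eq_mul_inv]
      · rw [Set.indicator_of_notMem hp]
        have : ¬ ((m : ZMod 2) = a ∧ (n : ZMod 2) = b) := fun h => hp ⟨hn.1, hn.2, h.1, h.2⟩
        unfold parityInd
        by_cases ha : (m : ZMod 2) = a
        · have hb : (n : ZMod 2) ≠ b := fun hb => this ⟨ha, hb⟩
          simp [hb]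
        · simp [ha]

/-- The sum of double zeta values of level `2` as a limit of simple sums. -/
lemma tendsto_sum_levelZeta (a b : ZMod 2) {w : ℕ} (hw : 2 ≤ w) :
    Tendsto (fun M : ℕ => 4 * ∑ n ∈ Finset.Icc 1 M, 1 / (n : ℝ) ^ w *
          (parityInd b n * (parityHarmonic (a - b) M - (parityHarmonic a M
            - parityHarmonic a n)) - parityInd a n * parityHarmonic (a - b) (n - 1)))
      atTop (𝓝 (∑ j ∈ Finset.Icc 2 w, levelZeta 2 j (w + 1 - j) a b)) := by
  have h := tendsto_finsetSum (Finset.Icc 2 w) fun j hj =>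
    tendsto_levelZeta a b (Finset.mem_Icc.1 hj).1
      (show 1 ≤ w + 1 - j by have := (Finset.mem_Icc.1 hj).2; omega)
  -- Adding this null sequence replaces H_{a-b}(M-n) by H_{a-b}(M).
  have h' := h.add ((tendsto_error b (a - b) hw).const_mul 4)
  rw [mul_zero, add_zero] at h'
  refine h'.congr fun M => ?_
  have e : ∑ j ∈ Finset.Icc 2 w, ∑ m ∈ Finset.Icc 1 M, ∑ n ∈ Finset.Ico 1 m,
      parityInd a m * parityInd b n * (4 * (1 / ((m : ℝ) ^ j * (n : ℝ) ^ (w + 1 - j))))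
      = 4 * ∑ m ∈ Finset.Icc 1 M, ∑ n ∈ Finset.Ico 1 m, parityInd a m * parityInd b n *
        ∑ j ∈ Finset.Icc 2 w, 1 / ((m : ℝ) ^ j * (n : ℝ) ^ (w + 1 - j)) := by
    rw [Finset.sum_comm, Finset.mul_sum]
    refine Finset.sum_congr rfl fun m _ => ?_
    rw [Finset.sum_comm, Finset.mul_sum]
    refine Finset.sum_congr rfl fun n _ => ?_
    rw [← Finset.mul_sum, ← Finset.mul_sum]
    ring
  rw [e, sum_triangle_eq a b (by omega), ← mul_add, ← Finset.sum_add_distrib]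
  congr 1
  exact Finset.sum_congr rfl fun n _ => by ring

/-! ### Even and odd parts of ζ(w + 1) -/

lemma one_div_pow_mul_parityInd_div (c : ZMod 2) (w n : ℕ) :
    1 / (n : ℝ) ^ w * (parityInd c n / n) = parityInd c n * (1 / (n : ℝ) ^ (w + 1)) := by
  rw [pow_succ, div_mul_div_comm, one_mul, mul_one_div]

lemma hasSum_even_part {w : ℕ} (hw : 1 ≤ w) :
    HasSum (fun n : ℕ => parityInd 0 n * (1 / (n : ℝ) ^ (w + 1)))
      (1 / 2 ^ (w + 1) * ∑' n : ℕ, 1 / (n : ℝ) ^ (w + 1)) := by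
  have hz := (Real.summable_one_div_nat_pow.2 (by omega : 1 < w + 1)).hasSum.mul_left
    ((1 : ℝ) / 2 ^ (w + 1))
  have hinj : Function.Injective fun n : ℕ => 2 * n := fun m n h => by simpa using h
  refine (hinj.hasSum_iff fun n hn => ?_).1 (hz.congr_fun fun n => ?_)
  · have : ¬ Even n := fun ⟨r, hr⟩ => hn ⟨r, by simp; omega⟩
    rw [parityInd, if_neg (by rwa [ZMod.natCast_eq_zero_iff_even]), zero_mul]
  · rw [Function.comp_apply, parityInd,
      if_pos ((ZMod.natCast_eq_zero_iff_even).2 (even_two_mul n))]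
    push_cast
    rw [mul_pow, one_mul, div_mul_div_comm, one_mul]

lemma tendsto_even_part {w : ℕ} (hw : 2 ≤ w) :
    Tendsto (fun M : ℕ => ∑ n ∈ Finset.Icc 1 M, 1 / (n : ℝ) ^ w * (parityInd 0 n / n)) atTop
      (𝓝 (1 / 2 ^ (w + 1) * ∑' n : ℕ, 1 / (n : ℝ) ^ (w + 1))) := by
  have h := hasSum_even_part (show 1 ≤ w by omega)
  simp only [one_div_pow_mul_parityInd_div]
  rw [← h.tsum_eq]
  exact tendsto_sum_Icc_of_summable h.summable (by simp)

lemma tendsto_odd_part {w : ℕ} (hw : 2 ≤ w) :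
    Tendsto (fun M : ℕ => ∑ n ∈ Finset.Icc 1 M, 1 / (n : ℝ) ^ w * (parityInd 1 n / n)) atTop
      (𝓝 ((1 - 1 / 2 ^ (w + 1)) * ∑' n : ℕ, 1 / (n : ℝ) ^ (w + 1))) := by
  have hz := tendsto_sum_Icc_of_summable
    (Real.summable_one_div_nat_pow.2 (by omega : 1 < w + 1)) (by simp)
  rw [sub_mul, one_mul]
  refine (hz.sub (tendsto_even_part hw)).congr fun M => ?_
  rw [← Finset.sum_sub_distrib]
  refine Finset.sum_congr rfl fun n _ => ?_
  rw [one_div_pow_mul_parityInd_div, one_div_pow_mul_parityInd_div,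
    eq_sub_of_add_eq' (parityInd_zero_add_one n)]
  ring

/-! ### The four sum formulas -/

lemma sum_levelZeta_zero_zero {w : ℕ} (hw : 2 ≤ w) :
    ∑ j ∈ Finset.Icc 2 w, levelZeta 2 j (w + 1 - j) 0 0
      = 1 / 2 ^ (w - 1) * ∑' n : ℕ, 1 / (n : ℝ) ^ (w + 1) := by
  have e : (1 : ℝ) / 2 ^ (w - 1) = 4 * (1 / 2 ^ (w + 1)) := by
    rw [show w + 1 = (w - 1) + 2 by omega, pow_add]
    field_simp; norm_num
  rw [e, mul_assoc]
  refine tendsto_nhds_unique (tendsto_sum_levelZeta 0 0 hw)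
    (((tendsto_even_part hw).const_mul 4).congr fun M => ?_)
  congr 1
  refine Finset.sum_congr rfl fun n hn => ?_
  rw [sub_zero, parityHarmonic_eq_pred 0 (Finset.mem_Icc.1 hn).1]
  -- For even n all harmonic sums cancel except H_0(n) - H_0(n-1) = 1/n; odd n contribute nothing.
  rcases parityInd_cases n with ⟨h0, h1⟩ | ⟨h0, h1⟩ <;> simp only [h0] <;> ring

lemma sum_levelZeta_one_zero {w : ℕ} (hw : 2 ≤ w) :
    ∑ j ∈ Finset.Icc 2 w, levelZeta 2 j (w + 1 - j) 1 0
      = 2 * (altZeta w 1 1 0 - altZeta w 1 1 1) := by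
  refine tendsto_nhds_unique (tendsto_sum_levelZeta 1 0 hw)
    ((((tendsto_altPartialSum_first_bar hw 0).sub
      (tendsto_altPartialSum_first_bar hw 1)).const_mul 2).congr fun M => ?_)
  rw [altPartialSum_first_bar, altPartialSum_first_bar, ← Finset.sum_sub_distrib, Finset.mul_sum,
    Finset.mul_sum]
  refine Finset.sum_congr rfl fun n hn => ?_
  rw [sub_zero, parityHarmonic_eq_pred 1 (Finset.mem_Icc.1 hn).1]
  rcases parityInd_cases n with ⟨h0, h1⟩ | ⟨h0, h1⟩ <;>
    simp only [h0, h1, ZMod.val_zero, ZMod.val_one] <;> ring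

/-- For odd n the alternating sums produce H_1(n-1) - H_1(n) = -1/n, which the odd part of ζ(w + 1)
compensates. -/
lemma sum_levelZeta_zero_one {w : ℕ} (hw : 2 ≤ w) :
    ∑ j ∈ Finset.Icc 2 w, levelZeta 2 j (w + 1 - j) 0 1
      = 2 * (altZeta w 1 1 1 + altZeta 1 w 1 1 - altZeta w 1 1 0 - altZeta 1 w 1 0)
        + 4 * ((1 - 1 / 2 ^ (w + 1)) * ∑' n : ℕ, 1 / (n : ℝ) ^ (w + 1)) := by
  refine tendsto_nhds_unique (tendsto_sum_levelZeta 0 1 hw)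
    (((((((tendsto_altPartialSum_first_bar hw 1).add (tendsto_altPartialSum_one_bar hw 1)).sub
      (tendsto_altPartialSum_first_bar hw 0)).sub (tendsto_altPartialSum_one_bar hw 0)).const_mul
        2).add ((tendsto_odd_part hw).const_mul 4)).congr fun M => ?_)
  simp only [altPartialSum_first_bar, altPartialSum_one_bar]
  rw [← Finset.sum_add_distrib, ← Finset.sum_sub_distrib, ← Finset.sum_sub_distrib, Finset.mul_sum,
    Finset.mul_sum, Finset.mul_sum, ← Finset.sum_add_distrib]
  refine Finset.sum_congr rfl fun n hn => ?_
  rw [show (0 - 1 : ZMod 2) = 1 by decide, parityHarmonic_eq_pred 0 (Finset.mem_Icc.1 hn).1,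
    parityHarmonic_eq_pred 1 (Finset.mem_Icc.1 hn).1]
  rcases parityInd_cases n with ⟨h0, h1⟩ | ⟨h0, h1⟩ <;>
    simp only [h0, h1, ZMod.val_zero, ZMod.val_one] <;> ring

lemma sum_levelZeta_one_one {w : ℕ} (hw : 2 ≤ w) :
    ∑ j ∈ Finset.Icc 2 w, levelZeta 2 j (w + 1 - j) 1 1
      = 2 * (altZeta 1 w 1 0 - altZeta 1 w 1 1) := by
  refine tendsto_nhds_unique (tendsto_sum_levelZeta 1 1 hw)
    ((((tendsto_altPartialSum_one_bar hw 0).sub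
      (tendsto_altPartialSum_one_bar hw 1)).const_mul 2).congr fun M => ?_)
  rw [altPartialSum_one_bar, altPartialSum_one_bar, ← Finset.sum_sub_distrib, Finset.mul_sum,
    Finset.mul_sum]
  refine Finset.sum_congr rfl fun n hn => ?_
  rw [sub_self, parityHarmonic_eq_pred 0 (Finset.mem_Icc.1 hn).1,
    parityHarmonic_eq_pred 1 (Finset.mem_Icc.1 hn).1]
  rcases parityInd_cases n with ⟨h0, h1⟩ | ⟨h0, h1⟩ <;>
    simp only [h0, h1, ZMod.val_zero, ZMod.val_one] <;> ring

lemma ofReal_tsum_one_div_pow {k : ℕ} (hk : 1 < k) :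
    ((∑' n : ℕ, 1 / (n : ℝ) ^ k : ℝ) : ℂ) = riemannZeta k := by
  rw [zeta_nat_eq_tsum_of_gt_one hk]
  push_cast
  rfl

end DoubleZeta

theorem mainTheorem9 (k : ℕ) (hk : 3 ≤ k) :
    -- convergence of all the series that occur
    (∀ j ∈ Finset.Icc 2 (k - 1), ∀ a b : ZMod 2,
      Summable (fun p : DoubleZeta.levelIndex 2 a b => DoubleZeta.levelTerm 2 j (k - j) p)) ∧
    (∀ b : ZMod 2,
      Tendsto (DoubleZeta.altPartialSum (k - 1) 1 1 b) atTop
        (𝓝 (DoubleZeta.altZeta (k - 1) 1 1 b))) ∧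
    (∀ b : ZMod 2,
      Tendsto (DoubleZeta.altPartialSum 1 (k - 1) 1 b) atTop
        (𝓝 (DoubleZeta.altZeta 1 (k - 1) 1 b))) ∧
    -- both arguments without a bar
    ((∑ j ∈ Finset.Icc 2 (k - 1), DoubleZeta.levelZeta 2 j (k - j) 0 0 : ℝ) : ℂ)
      = 1 / 2 ^ (k - 2) * riemannZeta k ∧
    -- bar on the first argument
    ∑ j ∈ Finset.Icc 2 (k - 1), DoubleZeta.levelZeta 2 j (k - j) 1 0
      = 2 * (DoubleZeta.altZeta (k - 1) 1 1 0 - DoubleZeta.altZeta (k - 1) 1 1 1) ∧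
    -- bar on the second argument
    ((∑ j ∈ Finset.Icc 2 (k - 1), DoubleZeta.levelZeta 2 j (k - j) 0 1 : ℝ) : ℂ)
      = ((2 * (DoubleZeta.altZeta (k - 1) 1 1 1 + DoubleZeta.altZeta 1 (k - 1) 1 1
            - DoubleZeta.altZeta (k - 1) 1 1 0 - DoubleZeta.altZeta 1 (k - 1) 1 0) : ℝ) : ℂ)
          + 4 * (1 - 1 / 2 ^ k) * riemannZeta k ∧
    -- bar on both arguments
    ∑ j ∈ Finset.Icc 2 (k - 1), DoubleZeta.levelZeta 2 j (k - j) 1 1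
      = 2 * (DoubleZeta.altZeta 1 (k - 1) 1 0 - DoubleZeta.altZeta 1 (k - 1) 1 1) := by
  obtain ⟨w, rfl⟩ := Nat.exists_eq_add_of_le' (show 1 ≤ k by omega)
  have hw : 2 ≤ w := by omega
  simp only [Nat.add_sub_cancel]
  refine ⟨fun j hj a b => ?_, DoubleZeta.tendsto_altPartialSum_first_bar hw,
    DoubleZeta.tendsto_altPartialSum_one_bar hw, ?_, DoubleZeta.sum_levelZeta_one_zero hw, ?_,
    DoubleZeta.sum_levelZeta_one_one hw⟩
  · have := Finset.mem_Icc.1 hj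
    exact DoubleZeta.summable_levelTerm a b this.1 (by omega)
  · rw [DoubleZeta.sum_levelZeta_zero_zero hw,
      ← DoubleZeta.ofReal_tsum_one_div_pow (show 1 < w + 1 by omega), Complex.ofReal_mul]
    simp
  · rw [DoubleZeta.sum_levelZeta_zero_one hw,
      ← DoubleZeta.ofReal_tsum_one_div_pow (show 1 < w + 1 by omega)]
    simp only [Complex.ofReal_add, Complex.ofReal_mul, Complex.ofReal_sub, Complex.ofReal_div,
      Complex.ofReal_pow, Complex.ofReal_one, Complex.ofReal_ofNat]
    ring
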